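/- Let $T$ be a finite rooted tree, that is, a finite connected digraph without loops having a vertex of in-degree $0$ (the root) such that every other vertex has in-degree $1$. Let $T$ have order $n\ge 2$, $\ell$ leaves (vertices of out-degree $0$) and $s$ support vertices (in-neighbors of leaves). Write $N^+_D[v]$ for the closed out-neighborhood of a vertex $v$ in a digraph $D$. A set $B\subseteq V(T)$ is a packing if $|N^+_T[v]\cap B|\le 1$ for all $v\in V(T)$, and $\rho(T)$ is the maximum cardinality of a packing. Let $S_m$ ($m\ge2$) denote the directed star of order $m$, i.e. the rooted tree with $m$ vertices and height $1$. A pruned tree $T'$ is obtained from $T$ by deleting, for each support vertex $u$, exactly $\ell(u)-1$ of the $\ell(u)$ leaves adjacent from $u$. A star elimination of a rooted tree $D$ with root $r$ proceeds as follows. Put $D_1=D$. As long as $D_i$ has at least two vertices, choose a leaf $v_i$ of $D_i$ at maximum distance from $r$, let $u_i$ be the in-neighbor of $v_i$ in $D_i$, and put $D_{i+1}=D_i-N^+_{D_i}[u_i]$. The process stops when all vertices have been removed or when only the isolated vertex $r$ is left. The directed stars $N^+_{D_i}[u_i]$, together with $\{r\}$ in the second case, partition $V(D)$. Let $\Phi$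 be the family of all rooted trees $D$ that have a star elimination such that (a) it removes all vertices and every directed star $N^+_{D_i}[u_i]$ is isomorphic to $S_2$; or (b) it ends with the isolated vertex $r$ and every directed star $N^+_{D_i}[u_i]$ is isomorphic to $S_2$; or (c) it ends with the isolated vertex $r$, one of the directed stars $N^+_{D_i}[u_i]$ is isomorphic to $S_3$ and all the others are isomorphic to $S_2$. Then: (i) $\rho(T)=s$ if and only if either $n=\ell+s$, or $n\neq\ell+s$ and every vertex of $T$ that is neither a support vertex nor a leaf is adjacent from a support vertex of $T$. (ii) A pruned tree $T'$ exists, and for every choice of the deleted leaves, $\rho(T)=\left\lceil\frac{n-\ell+s}{2}\right\rceil$ if and only if $T'\in\Phi$. -/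

import Mathlib

namespace Digraph

universe u

variable {V : Type u}

/-- `N⁺[v]`, the closed out-neighborhood of `v`. -/
def closedOutNbhd (D : Digraph V) (v : V) : Set V :=
  {w | D.Adj v w} ∪ {v}

/-- `B` is a packing if `|N⁺[v] ∩ B| ≤ 1` for every vertex `v`. -/
def IsPacking (D : Digraph V) (B : Set V) : Prop :=
  ∀ v, (D.closedOutNbhd v ∩ B).ncard ≤ 1

/-- The packing number `ρ(D)` of a finite digraph: the largest cardinality of a packing. -/
noncomputable def packingNumber (D : Digraph V) : ℕ :=
  sSup {k | ∃ B : Set V, D.IsPacking B ∧ B.ncard = k}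

/-- A loopless connected digraph in which `r` has in-degree `0` and every other vertex has
in-degree `1`. -/
structure IsRootedTreeAt (D : Digraph V) (r : V) : Prop where
  loopless : ∀ v, ¬ D.Adj v v
  connected : D.toSimpleGraphInclusive.Connected
  root : {u | D.Adj u r}.ncard = 0
  parent : ∀ v, v ≠ r → {u | D.Adj u v}.ncard = 1

/-- A rooted tree (with some root, which is then unique). -/
def IsRootedTree (D : Digraph V) : Prop :=
  ∃ r, D.IsRootedTreeAt r

/-- The leaves: the vertices of out-degree `0`. -/
def leaves (D : Digraph V) : Set V :=
  {v | ∀ w, ¬ D.Adj v w}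

/-- The support vertices: the in-neighbors of leaves. -/
def supportVertices (D : Digraph V) : Set V :=
  {u | ∃ v ∈ D.leaves, D.Adj u v}

/-- The leaves adjacent from `u`; their number is `ℓ(u)`. -/
def leafNbrs (D : Digraph V) (u : V) : Set V :=
  {v | v ∈ D.leaves ∧ D.Adj u v}

/-- The subdigraph induced by a set of vertices. -/
def induce (D : Digraph V) (S : Set V) : Digraph S where
  Adj a b := D.Adj a b

/-- `R` consists of exactly `ℓ(u) - 1` leaves adjacent from `u`, for each support vertex `u`.
The pruned tree `T'` is then `T.induce Rᶜ`. -/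
def IsPruningSet (D : Digraph V) (R : Set V) : Prop :=
  R ⊆ D.leaves ∧ ∀ u ∈ D.supportVertices, (R ∩ D.leafNbrs u).ncard = (D.leafNbrs u).ncard - 1

/-- The directed star `S_n` (for `n ≥ 2`): the rooted tree with `n` vertices and height `1`,
the root being the vertex `0`. -/
def directedStar (n : ℕ) : Digraph (Fin n) where
  Adj i j := i.val = 0 ∧ j.val ≠ 0

/-- The subdigraph of `D` induced by `S` is isomorphic to `S_n`. -/
def IsStarOn (D : Digraph V) (S : Set V) (n : ℕ) : Prop :=
  Nonempty ((D.induce S).Adj ≃r (directedStar n).Adj)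

/-- `v` is a leaf of the subdigraph of `D` induced by `W`. -/
def IsLeafIn (D : Digraph V) (W : Set V) (v : V) : Prop :=
  v ∈ W ∧ ∀ w ∈ W, ¬ D.Adj v w

/-- `D.StarElimination r W P Z`: starting from the tree on the vertex set `W`, with root `r`, one
can repeatedly choose a leaf `v` of the current tree at maximum distance from `r`, take
its support vertex `x` in the current tree, and remove the closed out-neighborhood of `x` in the
current tree; `P` is the list of the removed closed out-neighborhoods, in order, and `Z` is the
set of vertices that remain. (The distance from the root of a rooted tree to a vertex is the same
in the tree, in the current tree and in the underlying graph.) -/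
inductive StarElimination (D : Digraph V) (r : V) : Set V → List (Set V) → Set V → Prop
  | done (W : Set V) : StarElimination D r W [] W
  | step (W : Set V) (v x : V) (P : List (Set V)) (Z : Set V)
      (leaf : D.IsLeafIn W v)
      (farthest : ∀ w, D.IsLeafIn W w →
        D.toSimpleGraphInclusive.dist r w ≤ D.toSimpleGraphInclusive.dist r v)
      (mem : x ∈ W) (adj : D.Adj x v)
      (rest : StarElimination D r (W \ D.closedOutNbhd x) P Z) :
      StarElimination D r W ((D.closedOutNbhd x ∩ W) :: P) Z

/-- The vertex set has the partition `P`, produced by an elimination that removes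
all vertices. -/
def IsPartitionOne (D : Digraph V) (r : V) (P : List (Set V)) : Prop :=
  D.StarElimination r Set.univ P ∅

/-- The vertex set has the partition consisting of the members of `P` and of `{r}`, produced by an
elimination that ends with the isolated vertex `r`. -/
def IsPartitionTwo (D : Digraph V) (r : V) (P : List (Set V)) : Prop :=
  D.StarElimination r Set.univ P {r}

/-- The family `Φ` of rooted trees. -/
def MemPhi (D : Digraph V) : Prop :=
  ∃ r, D.IsRootedTreeAt r ∧
    ((∃ P, D.IsPartitionOne r P ∧ ∀ S ∈ P, D.IsStarOn S 2) ∨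
     (∃ P, D.IsPartitionTwo r P ∧ ∀ S ∈ P, D.IsStarOn S 2) ∨
     (∃ P, D.IsPartitionTwo r P ∧
        ∃ S ∈ P, D.IsStarOn S 3 ∧ ∀ S' ∈ P, S' ≠ S → D.IsStarOn S' 2))

end Digraph

namespace Digraph

variable {V : Type*} {D : Digraph V} {r : V}

/-! A closed out-neighborhood meets a packing at most once, so no packing is larger than a
dominating set; a packing and a dominating set of equal size therefore determine `ρ`.

A star elimination supplies both. The chosen leaves and their in-neighbors, each together with the
remaining vertex if there is one, form a packing and a dominating set, so `ρ` is the number of stars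
plus the number of remaining vertices (`packingNumber_eq_of_starElimination`). The stars have at
least two vertices each and partition the rest, so comparing `ρ` with half the order shows that `ρ`
is this half rounded up exactly when every star has order 2, except for one possible `S_3` if the
root remains. This is `Φ`.

Pruning leaves `ρ` unchanged (`packingNumber_induce_compl`) and brings the order down to `n - ℓ +
s`, which gives (ii). For (i), one leaf below each support vertex gives a packing of size `s`. If
the support vertices dominate, it is maximum; otherwise an undominated vertex can be added to it. -/

lemma mem_closedOutNbhd {v w : V} : w ∈ D.closedOutNbhd v ↔ D.Adj v w ∨ w = v := by
  simp [closedOutNbhd, or_comm]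

lemma IsRootedTreeAt.exists_parent (h : D.IsRootedTreeAt r) {v : V} (hv : v ≠ r) : ∃ u, D.Adj u v := by
  obtain ⟨u, hu⟩ := Set.ncard_eq_one.1 (h.parent v hv)
  exact ⟨u, (hu ▸ Set.mem_singleton u : u ∈ {u | D.Adj u v})⟩

lemma IsRootedTreeAt.ne_of_adj (h : D.IsRootedTreeAt r) {u v : V} (huv : D.Adj u v) : u ≠ v := by
  rintro rfl
  exact h.loopless u huv

lemma IsStarOn.ncard_eq {S : Set V} {k : ℕ} (h : D.IsStarOn S k) : S.ncard = k := by
  obtain ⟨e⟩ := h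
  rw [← Nat.card_coe_set_eq, Nat.card_congr e.toEquiv, Nat.card_fin]

lemma packingNumber_le {k : ℕ} (h : ∀ B, D.IsPacking B → B.ncard ≤ k) : D.packingNumber ≤ k := by
  refine csSup_le ⟨0, ∅, by simp [IsPacking], by simp⟩ ?_
  rintro _ ⟨B, hB, rfl⟩
  exact h B hB

/-- The support vertices used dominate, together with what remains. -/
lemma exists_dominating_of_starElimination {W Z : Set V} {P : List (Set V)}
    (hP : D.StarElimination r W P Z) :
    ∃ A : Set V, (∀ w ∈ W, ∃ a ∈ A, w ∈ D.closedOutNbhd a) ∧ A.ncard ≤ P.length + Z.ncard := by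
  induction hP with
  | done W => exact ⟨W, fun w hw => ⟨w, hw, mem_closedOutNbhd.2 (Or.inr rfl)⟩, by simp⟩
  | step W v x P Z leaf farthest mem adj rest ih =>
    obtain ⟨A, hA, hcard⟩ := ih
    refine ⟨insert x A, fun w hw => ?_, ?_⟩
    · by_cases hwx : w ∈ D.closedOutNbhd x
      · exact ⟨x, Set.mem_insert _ _, hwx⟩
      · obtain ⟨a, ha, haw⟩ := hA w ⟨hw, hwx⟩
        exact ⟨a, Set.mem_insert_of_mem _ ha, haw⟩
    · have := Set.ncard_insert_le x A
      rw [List.length_cons]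
      omega

variable [Finite V]

/-! ### Packings and domination -/

lemma isPacking_iff {B : Set V} :
    D.IsPacking B ↔ ∀ v, ∀ a ∈ B, ∀ b ∈ B, a ∈ D.closedOutNbhd v → b ∈ D.closedOutNbhd v →
      a = b := by
  refine forall_congr' fun v => ?_
  rw [Set.ncard_le_one (Set.toFinite _)]
  exact ⟨fun h a ha b hb hav hbv => h a ⟨hav, ha⟩ b ⟨hbv, hb⟩,
    fun h a ha b hb => h a ha.2 b hb.2 ha.1 hb.1⟩

lemma IsPacking.ncard_le_packingNumber {B : Set V} (hB : D.IsPacking B) :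
    B.ncard ≤ D.packingNumber := by
  refine le_csSup ⟨Nat.card V, ?_⟩ ⟨B, hB, rfl⟩
  rintro _ ⟨B, -, rfl⟩
  exact Set.ncard_le_card B

/-- A packing has at most as many elements as a dominating set. -/
lemma IsPacking.ncard_le_of_dominating {A B : Set V} (hB : D.IsPacking B)
    (hA : ∀ v, ∃ a ∈ A, v ∈ D.closedOutNbhd a) : B.ncard ≤ A.ncard := by
  choose f hfA hf using hA
  refine Set.ncard_le_ncard_of_injOn f (fun a _ => hfA a) (fun a ha b hb hab => ?_)
    (Set.toFinite _)
  exact isPacking_iff.1 hB (f a) a ha b hb (hf a) (hab ▸ hf b)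

/-! ### Rooted trees -/

namespace IsRootedTreeAt

lemma not_adj_root (h : D.IsRootedTreeAt r) (u : V) : ¬ D.Adj u r := fun hu => by
  have h0 := (Set.ncard_eq_zero (Set.toFinite _)).1 h.root
  exact (h0 ▸ (show u ∈ {u | D.Adj u r} from hu) : u ∈ (∅ : Set V))

lemma parent_unique (h : D.IsRootedTreeAt r) {u u' v : V} (hu : D.Adj u v) (hu' : D.Adj u' v) :
    u = u' := by
  have hv : v ≠ r := fun e => h.not_adj_root u (e ▸ hu)
  obtain ⟨a, ha⟩ := Set.ncard_eq_one.1 (h.parent v hv)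
  have h1 : u ∈ {u | D.Adj u v} := hu
  have h2 : u' ∈ {u | D.Adj u v} := hu'
  rw [ha] at h1 h2
  exact h1.trans h2.symm

/-- The distance from the root grows by one along each arc. -/
lemma dist_eq_add_one (h : D.IsRootedTreeAt r) {u v : V} (huv : D.Adj u v) :
    D.toSimpleGraphInclusive.dist r v = D.toSimpleGraphInclusive.dist r u + 1 := by
  induction hk : D.toSimpleGraphInclusive.dist r v using Nat.strong_induction_on
    generalizing u v with
  | _ k ih =>
    have hv : v ≠ r := fun e => h.not_adj_root u (e ▸ huv)
    obtain ⟨p, hp⟩ := h.connected.exists_walk_length_eq_dist v r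
    cases p with
    | nil => exact absurd rfl hv
    | @cons _ w _ hvw q =>
      rw [SimpleGraph.dist_comm, hk, SimpleGraph.Walk.length_cons] at hp
      have hw : D.toSimpleGraphInclusive.dist r w ≤ q.length :=
        SimpleGraph.dist_comm (G := D.toSimpleGraphInclusive) ▸ SimpleGraph.dist_le q
      have hw' : k ≤ D.toSimpleGraphInclusive.dist r w + 1 := by
        have := h.connected.dist_triangle (u := r) (v := w) (w := v)
        rw [SimpleGraph.dist_eq_one_iff_adj.2 hvw.symm, hk] at this
        exact this
      -- The first step of a shortest walk to the root cannot follow an arc out of `v`: by induction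
      -- that would increase the distance. So it goes to the in-neighbor.
      obtain ⟨-, hvw | hwv⟩ := hvw
      · have := ih _ (by omega) hvw rfl
        omega
      · rw [h.parent_unique huv hwv]
        omega

lemma not_adj_symm (h : D.IsRootedTreeAt r) {u v : V} (huv : D.Adj u v) : ¬ D.Adj v u := by
  intro hvu
  have h1 := h.dist_eq_add_one huv
  have h2 := h.dist_eq_add_one hvu
  omega

/-! ### Star eliminations -/

/-- The removed sets together with the remaining set have the right number of elements, each
removed set has at least two elements, and the removed sets are distinct. -/
lemma starElimination_sizes (h : D.IsRootedTreeAt r) {W Z : Set V} {P : List (Set V)}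
    (hP : D.StarElimination r W P Z) :
    W.ncard = (P.map Set.ncard).sum + Z.ncard ∧
    (∀ S ∈ P, S ⊆ W ∧ 2 ≤ S.ncard ∧ ∃ x ∈ S, S ⊆ D.closedOutNbhd x) ∧ P.Nodup := by
  induction hP with
  | done W => simp
  | step W v x P Z leaf farthest mem adj rest ih =>
    obtain ⟨ih1, ih2, ih3⟩ := ih
    refine ⟨?_, ?_, ?_⟩
    · have := Set.ncard_inter_add_ncard_sdiff_eq_ncard W (D.closedOutNbhd x)
      rw [Set.inter_comm] at this
      simp only [List.map_cons, List.sum_cons]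
      omega
    · intro S hS
      rcases List.mem_cons.1 hS with rfl | hS
      · refine ⟨Set.inter_subset_right, ?_, x, ⟨mem_closedOutNbhd.2 (Or.inr rfl), mem⟩,
          Set.inter_subset_left⟩
        rw [← Set.ncard_pair (h.ne_of_adj adj)]
        refine Set.ncard_le_ncard ?_ (Set.toFinite _)
        rintro y (rfl | rfl)
        · exact ⟨mem_closedOutNbhd.2 (Or.inr rfl), mem⟩
        · exact ⟨mem_closedOutNbhd.2 (Or.inl adj), leaf.1⟩
      · obtain ⟨h1, h2⟩ := ih2 S hS
        exact ⟨h1.trans Set.sdiff_subset, h2⟩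
    · refine List.nodup_cons.2 ⟨fun hS => ?_, ih3⟩
      exact ((ih2 _ hS).1 ⟨mem_closedOutNbhd.2 (Or.inr rfl), mem⟩).2
        (mem_closedOutNbhd.2 (Or.inr rfl))

/-- The chosen leaves form a packing, together with what remains. -/
lemma exists_packing_of_starElimination (h : D.IsRootedTreeAt r) {W Z : Set V}
    {P : List (Set V)} (hP : D.StarElimination r W P Z) (hZ : Z.Subsingleton) :
    ∃ B ⊆ W, D.IsPacking B ∧ B.ncard = P.length + Z.ncard := by
  induction hP with
  | done W => exact ⟨W, le_rfl, isPacking_iff.2 fun _ a ha b hb _ _ => hZ ha hb, by simp⟩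
  | step W v x P Z leaf farthest mem adj rest ih =>
    obtain ⟨B, hBW, hB, hcard⟩ := ih hZ
    have hvx : v ∈ D.closedOutNbhd x := mem_closedOutNbhd.2 (Or.inl adj)
    -- Only `x` and `v` have `v` in their closed out-neighborhood: that of `x` has been removed, and
    -- `v` has no out-neighbor in `W`.
    have key : ∀ w, v ∈ D.closedOutNbhd w → ∀ b ∈ B, b ∉ D.closedOutNbhd w := by
      intro w hw b hb hbw
      rcases mem_closedOutNbhd.1 hw with hw | rfl
      · exact (hBW hb).2 (h.parent_unique hw adj ▸ hbw)
      · rcases mem_closedOutNbhd.1 hbw with hbv | rfl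
        · exact leaf.2 b (hBW hb).1 hbv
        · exact (hBW hb).2 hvx
    refine ⟨insert v B, Set.insert_subset leaf.1 (hBW.trans Set.sdiff_subset),
      isPacking_iff.2 ?_, ?_⟩
    · rintro w a (rfl | ha) b (rfl | hb) haw hbw
      · rfl
      · exact absurd hbw (key w haw b hb)
      · exact absurd haw (key w hbw a ha)
      · exact isPacking_iff.1 hB w a ha b hb haw hbw
    · rw [Set.ncard_insert_of_notMem (fun hv => (hBW hv).2 hvx), hcard, List.length_cons]
      omega

lemma packingNumber_eq_of_starElimination (h : D.IsRootedTreeAt r) {Z : Set V}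
    {P : List (Set V)} (hP : D.StarElimination r Set.univ P Z) (hZ : Z.Subsingleton) :
    D.packingNumber = P.length + Z.ncard := by
  obtain ⟨B, -, hB, hBc⟩ := h.exists_packing_of_starElimination hP hZ
  obtain ⟨A, hA, hAc⟩ := exists_dominating_of_starElimination hP
  refine le_antisymm (packingNumber_le fun B' hB' => ?_) (hBc ▸ hB.ncard_le_packingNumber)
  exact (hB'.ncard_le_of_dominating fun v => hA v (Set.mem_univ v)).trans hAc

/-- A deepest vertex of a set closed under in-neighbors is a farthest leaf, and its in-neighbor is
still present unless it is the root. -/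
lemma exists_starElimination (h : D.IsRootedTreeAt r) (W : Set V)
    (hW : ∀ u v, v ∈ W → D.Adj u v → u ∈ W) :
    ∃ P Z, D.StarElimination r W P Z ∧ (Z = ∅ ∨ Z = {r}) := by
  induction hk : W.ncard using Nat.strong_induction_on generalizing W with
  | _ k ih =>
    rcases W.eq_empty_or_nonempty with rfl | hne
    · exact ⟨[], ∅, .done _, Or.inl rfl⟩
    obtain ⟨v, hvW, hv⟩ := Set.exists_max_image W (D.toSimpleGraphInclusive.dist r)
      (Set.toFinite _) hne
    by_cases hvr : v = r
    · refine ⟨[], W, .done _, Or.inr (Set.eq_singleton_iff_unique_mem.2 ⟨hvr ▸ hvW, ?_⟩)⟩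
      intro w hw
      have := hv w hw
      rw [hvr, SimpleGraph.dist_self, Nat.le_zero, h.connected.dist_eq_zero_iff] at this
      exact this.symm
    obtain ⟨x, hx⟩ := h.exists_parent hvr
    have hxW := hW x v hvW hx
    have hvx := h.dist_eq_add_one hx
    obtain ⟨P, Z, hP, hZ⟩ := ih _ (hk ▸ Set.ncard_lt_ncard
      (Set.ssubset_iff_of_subset Set.sdiff_subset |>.2
        ⟨x, hxW, fun hx' => hx'.2 (mem_closedOutNbhd.2 (Or.inr rfl))⟩) (Set.toFinite _))
      -- Closure under in-neighbors survives: a vertex below an out-neighbor of `x` would be deeper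
      -- than `v`.
      (W \ D.closedOutNbhd x) (fun u w hw huw => ⟨hW u w hw.1 huw, fun hux => by
        rcases mem_closedOutNbhd.1 hux with hux | rfl
        · have h1 := h.dist_eq_add_one hux
          have h2 := h.dist_eq_add_one huw
          have h3 := hv w hw.1
          omega
        · exact hw.2 (mem_closedOutNbhd.2 (Or.inl huw))⟩) rfl
    refine ⟨_, Z, .step W v x P Z ⟨hvW, fun w hw hvw => ?_⟩ (fun w hw => hv w hw.1) hxW hx hP, hZ⟩
    have h1 := h.dist_eq_add_one hvw
    have h3 := hv w hw
    omega

/-! ### Stars -/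

lemma isStarOn_ncard (h : D.IsRootedTreeAt r) {S : Set V} {x : V} (hx : x ∈ S)
    (hS : S ⊆ D.closedOutNbhd x) : D.IsStarOn S S.ncard := by
  have hadj : ∀ a b : S, D.Adj a b ↔ a = ⟨x, hx⟩ ∧ b ≠ ⟨x, hx⟩ := by
    rintro ⟨a, ha⟩ ⟨b, hb⟩
    simp only [Subtype.mk.injEq, ne_eq]
    constructor
    · intro hab
      rcases mem_closedOutNbhd.1 (hS hb) with hxb | rfl
      · exact ⟨h.parent_unique hab hxb, (h.ne_of_adj hxb).symm⟩
      · rcases mem_closedOutNbhd.1 (hS ha) with hxa | rfl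
        · exact absurd hab (h.not_adj_symm hxa)
        · exact absurd hab (h.loopless _)
    · rintro ⟨rfl, hba⟩
      exact (mem_closedOutNbhd.1 (hS hb)).resolve_right hba
  have hpos : 0 < S.ncard := (Set.ncard_pos (Set.toFinite _)).2 ⟨x, hx⟩
  let e₀ : S ≃ Fin S.ncard := Finite.equivFinOfCardEq (Nat.card_coe_set_eq S)
  -- The swap sends the center `x` to `0`, the root of `directedStar`.
  let e : S ≃ Fin S.ncard := e₀.trans (Equiv.swap (e₀ ⟨x, hx⟩) ⟨0, hpos⟩)
  have he : e ⟨x, hx⟩ = ⟨0, hpos⟩ := by simp [e]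
  have he0 : ∀ a : S, (e a).val = 0 ↔ a = ⟨x, hx⟩ := by
    intro a
    rw [← e.apply_eq_iff_eq, he, Fin.ext_iff]
  exact ⟨⟨e, fun {a b} => by
    simp only [directedStar, ne_eq, he0]
    exact (hadj a b).symm⟩⟩

end IsRootedTreeAt

end Digraph

/-! ### Arithmetic of star sizes and of the ceiling -/

namespace List

variable {α : Type*} {L : List α} {f : α → ℕ}

lemma two_mul_length_le_sum_map (h : ∀ a ∈ L, 2 ≤ f a) : 2 * L.length ≤ (L.map f).sum := by
  induction L with
  | nil => simp
  | cons a L ih =>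
    simp only [mem_cons, forall_eq_or_imp] at h
    have := ih h.2
    simp only [length_cons, map_cons, sum_cons]
    omega

lemma sum_map_eq_two_mul_length_iff (h : ∀ a ∈ L, 2 ≤ f a) :
    (L.map f).sum = 2 * L.length ↔ ∀ a ∈ L, f a = 2 := by
  induction L with
  | nil => simp
  | cons a L ih =>
    simp only [mem_cons, forall_eq_or_imp] at h
    simp only [length_cons, map_cons, sum_cons, mem_cons, forall_eq_or_imp, ← ih h.2]
    have := two_mul_length_le_sum_map h.2
    omega

/-- `Nodup` is essential: `b ≠ a` exempts every occurrence of `a`, so a repeated entry of value 3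
would satisfy the right side with a larger sum. -/
lemma sum_map_eq_two_mul_length_add_one_iff (h : ∀ a ∈ L, 2 ≤ f a) (hL : L.Nodup) :
    (L.map f).sum = 2 * L.length + 1 ↔ ∃ a ∈ L, f a = 3 ∧ ∀ b ∈ L, b ≠ a → f b = 2 := by
  classical
  have herase : ∀ a ∈ L, (L.map f).sum = f a + ((L.erase a).map f).sum ∧
      L.length = (L.erase a).length + 1 ∧
      ((∀ b ∈ L, b ≠ a → f b = 2) ↔ ((L.erase a).map f).sum = 2 * (L.erase a).length) ∧
      2 * (L.erase a).length ≤ ((L.erase a).map f).sum := by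
    intro a ha
    have hp := perm_cons_erase ha
    have h2 : ∀ b ∈ L.erase a, 2 ≤ f b := fun b hb => h b (mem_of_mem_erase hb)
    refine ⟨by rw [(hp.map f).sum_eq, map_cons, sum_cons], hp.length_eq, ?_,
      two_mul_length_le_sum_map h2⟩
    rw [sum_map_eq_two_mul_length_iff h2]
    simp only [hL.mem_erase_iff]
    grind
  constructor
  · intro hsum
    obtain ⟨a, ha, hfa⟩ : ∃ a ∈ L, f a ≠ 2 := by
      by_contra! hall
      have := (sum_map_eq_two_mul_length_iff h).2 hall
      omega
    obtain ⟨h1, h2, h3, h4⟩ := herase a ha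
    have := h a ha
    exact ⟨a, ha, by omega, h3.2 (by omega)⟩
  · rintro ⟨a, ha, hfa, hall⟩
    obtain ⟨h1, h2, h3, -⟩ := herase a ha
    have := h3.1 hall
    omega

end List

lemma Nat.cast_eq_ceil_half_iff (k m : ℕ) :
    (k : ℤ) = ⌈(m : ℚ) / 2⌉ ↔ 2 * k = m ∨ 2 * k = m + 1 := by
  rw [eq_comm, Int.ceil_eq_iff]
  constructor
  · rintro ⟨h1, h2⟩
    have h1' : 2 * (k : ℚ) < m + 2 := by push_cast at h1; linarith
    have h2' : (m : ℚ) ≤ 2 * k := by push_cast at h2; linarith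
    norm_cast at h1' h2'
    omega
  · rintro (h | h)
    · rw [← h]; push_cast; constructor <;> linarith
    · have : (m : ℚ) = 2 * k - 1 := by rw [eq_sub_iff_add_eq]; exact_mod_cast h.symm
      rw [this]; push_cast; constructor <;> linarith

/-! ### The family `Φ` -/

namespace Digraph

variable {V : Type*} {D : Digraph V} {r : V}

lemma exists_mem_of_ncard_inter_leafNbrs {K : Set V} (hK : ∀ u ∈ D.supportVertices,
    (K ∩ D.leafNbrs u).ncard = 1) {u : V} (hu : u ∈ D.supportVertices) :
    ∃ v ∈ K, v ∈ D.leaves ∧ D.Adj u v := by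
  obtain ⟨v, hv⟩ := Set.ncard_eq_one.1 (hK u hu)
  have : v ∈ K ∩ D.leafNbrs u := hv ▸ rfl
  exact ⟨v, this.1, this.2⟩

variable [Finite V]

lemma IsRootedTreeAt.isStarOn_iff (h : D.IsRootedTreeAt r) {W Z : Set V} {P : List (Set V)}
    (hP : D.StarElimination r W P Z) {S : Set V} (hS : S ∈ P) (k : ℕ) :
    D.IsStarOn S k ↔ S.ncard = k := by
  obtain ⟨-, -, x, hx, hSx⟩ := (h.starElimination_sizes hP).2.1 S hS
  exact ⟨IsStarOn.ncard_eq, fun hk => hk ▸ h.isStarOn_ncard hx hSx⟩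

/-- The rooted trees whose packing number is half the order, rounded up, are those in `Φ`. -/
theorem packingNumber_eq_ceil_iff_memPhi (hD : D.IsRootedTree) :
    (D.packingNumber : ℤ) = ⌈(Nat.card V : ℚ) / 2⌉ ↔ D.MemPhi := by
  rw [Nat.cast_eq_ceil_half_iff]
  constructor
  · intro hρ
    obtain ⟨r, hr⟩ := hD
    refine ⟨r, hr, ?_⟩
    obtain ⟨P, Z, hP, hZ⟩ := hr.exists_starElimination Set.univ fun _ _ _ _ => Set.mem_univ _
    obtain ⟨hsum, h2, hnd⟩ := hr.starElimination_sizes hP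
    have h2' : ∀ S ∈ P, 2 ≤ S.ncard := fun S hS => (h2 S hS).2.1
    have hlen := List.two_mul_length_le_sum_map h2'
    rw [Set.ncard_univ] at hsum
    rcases hZ with rfl | rfl
    · rw [hr.packingNumber_eq_of_starElimination hP Set.subsingleton_empty,
        Set.ncard_empty] at hρ
      rw [Set.ncard_empty] at hsum
      refine Or.inl ⟨P, hP, fun S hS => (hr.isStarOn_iff hP hS 2).2 ?_⟩
      exact (List.sum_map_eq_two_mul_length_iff h2').1 (by omega) S hS
    · rw [hr.packingNumber_eq_of_starElimination hP Set.subsingleton_singleton,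
        Set.ncard_singleton] at hρ
      rw [Set.ncard_singleton] at hsum
      by_cases heq : (P.map Set.ncard).sum = 2 * P.length
      · refine Or.inr (Or.inl ⟨P, hP, fun S hS => (hr.isStarOn_iff hP hS 2).2 ?_⟩)
        exact (List.sum_map_eq_two_mul_length_iff h2').1 heq S hS
      · obtain ⟨S, hS, hS3, hS2⟩ :=
          (List.sum_map_eq_two_mul_length_add_one_iff h2' hnd).1 (by omega)
        exact Or.inr (Or.inr ⟨P, hP, S, hS, (hr.isStarOn_iff hP hS 3).2 hS3,
          fun S' hS' hne => (hr.isStarOn_iff hP hS' 2).2 (hS2 S' hS' hne)⟩)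
  · rintro ⟨r, hr, ⟨P, hP, hstar⟩ | ⟨P, hP, hstar⟩ | ⟨P, hP, S, hS, hS3, hS2⟩⟩
    all_goals
      obtain ⟨hsum, h2, hnd⟩ := hr.starElimination_sizes hP
      have h2' : ∀ S ∈ P, 2 ≤ S.ncard := fun S hS => (h2 S hS).2.1
      rw [hr.packingNumber_eq_of_starElimination hP (by simp)]
      rw [Set.ncard_univ] at hsum
      simp only [Set.ncard_empty, Set.ncard_singleton] at hsum ⊢
    · have := (List.sum_map_eq_two_mul_length_iff h2').2 fun S hS => (hstar S hS).ncard_eq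
      omega
    · have := (List.sum_map_eq_two_mul_length_iff h2').2 fun S hS => (hstar S hS).ncard_eq
      omega
    · have := (List.sum_map_eq_two_mul_length_add_one_iff h2' hnd).2
        ⟨S, hS, hS3.ncard_eq, fun S' hS' hne => (hS2 S' hS' hne).ncard_eq⟩
      omega

/-! ### Leaves and support vertices -/

namespace IsRootedTreeAt

lemma root_notMem_leaves (h : D.IsRootedTreeAt r) (hV : 2 ≤ Nat.card V) : r ∉ D.leaves := by
  intro hr
  have : Nontrivial V := Finite.one_lt_card_iff_nontrivial.1 hV
  obtain ⟨v, hv⟩ := exists_ne r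
  obtain ⟨p, hp⟩ := h.connected.exists_walk_length_eq_dist r v
  cases p with
  | nil => exact hv rfl
  | cons hadj q =>
    obtain ⟨-, hadj | hadj⟩ := hadj
    · exact hr _ hadj
    · exact h.not_adj_root _ hadj

lemma exists_support_of_mem_leaves (h : D.IsRootedTreeAt r) (hV : 2 ≤ Nat.card V) {v : V}
    (hv : v ∈ D.leaves) : ∃ u ∈ D.supportVertices, D.Adj u v := by
  have hvr : v ≠ r := fun e => h.root_notMem_leaves hV (e ▸ hv)
  obtain ⟨u, hu⟩ := h.exists_parent hvr
  exact ⟨u, ⟨v, hv, hu⟩, hu⟩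

/-- A set of leaves with exactly one leaf below each support vertex. -/
lemma exists_leaf_transversal (h : D.IsRootedTreeAt r) :
    ∃ K ⊆ D.leaves, ∀ u ∈ D.supportVertices, (K ∩ D.leafNbrs u).ncard = 1 := by
  choose! f hf hfu using fun u (hu : u ∈ D.supportVertices) => hu
  refine ⟨f '' D.supportVertices, ?_, fun u hu => Set.ncard_eq_one.2 ⟨f u, ?_⟩⟩
  · rintro _ ⟨u, hu, rfl⟩
    exact hf u hu
  · ext w
    constructor
    · rintro ⟨⟨u', hu', rfl⟩, -, hw⟩
      rw [h.parent_unique hw (hfu u' hu')]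
      rfl
    · rintro rfl
      exact ⟨⟨u, hu, rfl⟩, hf u hu, hfu u hu⟩

end IsRootedTreeAt

variable {K : Set V}

lemma eq_of_ncard_inter_leafNbrs (hKl : K ⊆ D.leaves) (hK : ∀ u ∈ D.supportVertices,
    (K ∩ D.leafNbrs u).ncard = 1) {u v w : V} (hv : v ∈ K) (hw : w ∈ K) (huv : D.Adj u v)
    (huw : D.Adj u w) : v = w :=
  (Set.ncard_le_one (Set.toFinite _)).1 (hK u ⟨v, hKl hv, huv⟩).le v ⟨hv, hKl hv, huv⟩ w
    ⟨hw, hKl hw, huw⟩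

lemma eq_of_mem_leaf_transversal (hKl : K ⊆ D.leaves) (hK : ∀ u ∈ D.supportVertices, (K ∩ D.leafNbrs u).ncard = 1)
    {u v w : V} (hv : v ∈ K) (hw : w ∈ K) (huv : v ∈ D.closedOutNbhd u)
    (huw : w ∈ D.closedOutNbhd u) : v = w := by
  rcases mem_closedOutNbhd.1 huv with huv | rfl <;> rcases mem_closedOutNbhd.1 huw with huw | rfl
  · exact eq_of_ncard_inter_leafNbrs hKl hK hv hw huv huw
  · exact absurd huv (hKl hw v)
  · exact absurd huw (hKl hv w)
  · rfl

namespace IsRootedTreeAt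

lemma ncard_leaf_transversal (h : D.IsRootedTreeAt r) (hV : 2 ≤ Nat.card V)
    (hKl : K ⊆ D.leaves) (hK : ∀ u ∈ D.supportVertices, (K ∩ D.leafNbrs u).ncard = 1) :
    K.ncard = D.supportVertices.ncard := by
  choose! f hfs hf using fun v hv => h.exists_support_of_mem_leaves hV (v := v) hv
  refine Set.ncard_congr (fun v _ => f v) (fun v hv => hfs v (hKl hv)) ?_ ?_
  · intro v w hv hw hvw
    exact eq_of_ncard_inter_leafNbrs hKl hK hv hw (hf v (hKl hv)) (hvw ▸ hf w (hKl hw))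
  · intro u hu
    obtain ⟨v, hv, hvl, huv⟩ := exists_mem_of_ncard_inter_leafNbrs hK hu
    exact ⟨v, hv, h.parent_unique (hf v hvl) huv⟩

/-- The packing number equals the number of support vertices if and only if every vertex is a
leaf, a support vertex or adjacent from a support vertex. -/
theorem packingNumber_eq_ncard_supportVertices_iff (h : D.IsRootedTreeAt r)
    (hV : 2 ≤ Nat.card V) :
    D.packingNumber = D.supportVertices.ncard ↔
      ∀ x, x ∉ D.supportVertices → x ∉ D.leaves → ∃ u ∈ D.supportVertices, D.Adj u x := by
  obtain ⟨K, hKl, hK⟩ := h.exists_leaf_transversal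
  have hKs := h.ncard_leaf_transversal hV hKl hK
  constructor
  · intro hρ x hxs hxl
    by_contra! hx
    -- A vertex seeing a leaf of `K` is that leaf or a support vertex, and neither sees `x`.
    have key : ∀ w, x ∈ D.closedOutNbhd w → ∀ b ∈ K, b ∉ D.closedOutNbhd w := by
      intro w hw b hb hbw
      rcases mem_closedOutNbhd.1 hbw with hwb | rfl
      · rcases mem_closedOutNbhd.1 hw with hwx | rfl
        · exact hx w ⟨b, hKl hb, hwb⟩ hwx
        · exact hxs ⟨b, hKl hb, hwb⟩
      · rcases mem_closedOutNbhd.1 hw with hwx | rfl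
        · exact hKl hb x hwx
        · exact hxl (hKl hb)
    have hpack : D.IsPacking (insert x K) := by
      refine isPacking_iff.2 ?_
      rintro w a (rfl | ha) b (rfl | hb) haw hbw
      · rfl
      · exact absurd hbw (key w haw b hb)
      · exact absurd haw (key w hbw a ha)
      · exact eq_of_mem_leaf_transversal hKl hK ha hb haw hbw
    have := hpack.ncard_le_packingNumber
    rw [Set.ncard_insert_of_notMem (fun hxK => hxl (hKl hxK))] at this
    omega
  · intro hx
    refine le_antisymm (packingNumber_le fun B hB => hB.ncard_le_of_dominating fun v => ?_) ?_
    · by_cases hvs : v ∈ D.supportVertices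
      · exact ⟨v, hvs, mem_closedOutNbhd.2 (Or.inr rfl)⟩
      · obtain ⟨u, hu, huv⟩ : ∃ u ∈ D.supportVertices, D.Adj u v := by
          by_cases hvl : v ∈ D.leaves
          · exact h.exists_support_of_mem_leaves hV hvl
          · exact hx v hvs hvl
        exact ⟨u, hu, mem_closedOutNbhd.2 (Or.inl huv)⟩
    · rw [← hKs]
      exact (isPacking_iff.2 fun _ _ ha _ hb haw hbw =>
        eq_of_mem_leaf_transversal hKl hK ha hb haw hbw).ncard_le_packingNumber

end IsRootedTreeAt

lemma ncard_leaves_union_supportVertices :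
    (D.leaves ∪ D.supportVertices).ncard = D.leaves.ncard + D.supportVertices.ncard :=
  Set.ncard_union_eq (Set.disjoint_left.2 fun u hu ⟨v, _, huv⟩ => hu v huv)

/-! ### Pruned trees -/

/-- Since `ℓ(u) > 0`, the truncated `ℓ(u) - 1` is exact, so the kept leaves form a transversal. -/
lemma isPruningSet_iff {R : Set V} :
    D.IsPruningSet R ↔ R ⊆ D.leaves ∧
      ∀ u ∈ D.supportVertices, ((D.leaves \ R) ∩ D.leafNbrs u).ncard = 1 := by
  refine and_congr_right fun hR => forall₂_congr fun u hu => ?_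
  have h1 := Set.ncard_inter_add_ncard_sdiff_eq_ncard (D.leafNbrs u) R
  have h2 : D.leafNbrs u \ R = (D.leaves \ R) ∩ D.leafNbrs u := by
    ext v
    simp only [leafNbrs, Set.mem_sdiff, Set.mem_inter_iff, Set.mem_ofPred_eq]
    tauto
  have h3 : 0 < (D.leafNbrs u).ncard := by
    obtain ⟨v, hv, huv⟩ := hu
    exact (Set.ncard_pos (Set.toFinite _)).2 ⟨v, hv, huv⟩
  rw [h2, Set.inter_comm _ R] at h1
  omega

lemma IsRootedTreeAt.exists_isPruningSet (h : D.IsRootedTreeAt r) : ∃ R, D.IsPruningSet R := by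
  obtain ⟨K, hKl, hK⟩ := h.exists_leaf_transversal
  refine ⟨D.leaves \ K, isPruningSet_iff.2 ⟨Set.sdiff_subset, fun u hu => ?_⟩⟩
  rw [Set.sdiff_sdiff_cancel_left hKl]
  exact hK u hu

lemma IsRootedTreeAt.induce_compl (h : D.IsRootedTreeAt r) {R : Set V} (hR : R ⊆ D.leaves)
    (hr : r ∉ R) : (D.induce Rᶜ).IsRootedTreeAt ⟨r, hr⟩ where
  loopless v := h.loopless v
  connected := by
    have : Nonempty (Rᶜ : Set V) := ⟨⟨r, hr⟩⟩
    -- An in-neighbor is never a leaf, so the path from the root to a kept vertex survives.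
    have key : ∀ k, ∀ v : (Rᶜ : Set V), D.toSimpleGraphInclusive.dist r v = k →
        (D.induce Rᶜ).toSimpleGraphInclusive.Reachable ⟨r, hr⟩ v := by
      intro k
      induction k with
      | zero =>
        intro v hv
        have : (⟨r, hr⟩ : (Rᶜ : Set V)) = v := Subtype.ext (h.connected.dist_eq_zero_iff.1 hv)
        rw [this]
      | succ k ih =>
        intro v hv
        have hvr : (v : V) ≠ r := by
          intro e
          simp [e] at hv
        obtain ⟨u, hu⟩ := h.exists_parent hvr
        have hd := h.dist_eq_add_one hu
        refine (ih ⟨u, fun huR => hR huR _ hu⟩ (by simp only; omega)).trans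
          (SimpleGraph.Adj.reachable ⟨?_, Or.inl hu⟩)
        exact fun e => h.ne_of_adj hu (congrArg Subtype.val e)
    exact ⟨fun u v => (key _ u rfl).symm.trans (key _ v rfl)⟩
  root := (Set.ncard_eq_zero (Set.toFinite _)).2
    (Set.eq_empty_of_forall_notMem fun u hu => h.not_adj_root u hu)
  parent v hv := by
    obtain ⟨u, hu⟩ := h.exists_parent (v := v) fun e => hv (Subtype.ext e)
    refine Set.ncard_eq_one.2 ⟨⟨u, fun huR => hR huR _ hu⟩, ?_⟩
    ext w
    exact ⟨fun hw => Subtype.ext (h.parent_unique hw hu), fun hw => by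
      rw [Set.mem_singleton_iff] at hw
      subst hw
      exact hu⟩

lemma isPacking_induce_iff {S : Set V} {B : Set S} :
    (D.induce S).IsPacking B ↔
      ∀ v ∈ S, ∀ a ∈ B, ∀ b ∈ B, (a : V) ∈ D.closedOutNbhd v → (b : V) ∈ D.closedOutNbhd v →
        a = b := by
  rw [isPacking_iff, Subtype.forall]
  have hmem : ∀ v a : S, a ∈ (D.induce S).closedOutNbhd v ↔ (a : V) ∈ D.closedOutNbhd v := by
    intro v a
    rw [mem_closedOutNbhd, mem_closedOutNbhd, Subtype.ext_iff]
    rfl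
  simp only [hmem]

/-- Leaves with the same in-neighbor are interchangeable in a packing: each deleted leaf is replaced
by its kept sibling. -/
lemma IsRootedTreeAt.packingNumber_induce_compl (h : D.IsRootedTreeAt r) (hV : 2 ≤ Nat.card V)
    {R : Set V} (hR : D.IsPruningSet R) :
    (D.induce Rᶜ).packingNumber = D.packingNumber := by
  obtain ⟨hRl, hRu⟩ := isPruningSet_iff.1 hR
  apply le_antisymm
  · refine packingNumber_le fun B hB => ?_
    rw [← Set.ncard_image_of_injective B Subtype.val_injective]
    refine IsPacking.ncard_le_packingNumber (isPacking_iff.2 ?_)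
    rintro v _ ⟨a, ha, rfl⟩ _ ⟨b, hb, rfl⟩ hav hbv
    -- A deleted leaf sees only itself, so it imposes no new constraint.
    by_cases hv : v ∈ R
    · rcases mem_closedOutNbhd.1 hav with hva | rfl
      · exact absurd hva (hRl hv _)
      · exact absurd hv a.2
    · exact congrArg _ (isPacking_induce_iff.1 hB v hv a ha b hb hav hbv)
  · refine packingNumber_le fun B hB => ?_
    have hex : ∀ v, ∃ w ∉ R, (v ∉ R → w = v) ∧
        (v ∈ R → w ∈ D.leaves ∧ ∃ u, D.Adj u v ∧ D.Adj u w) := by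
      intro v
      by_cases hv : v ∈ R
      · obtain ⟨u, hus, huv⟩ := h.exists_support_of_mem_leaves hV (hRl hv)
        obtain ⟨w, hw, hwl, huw⟩ := exists_mem_of_ncard_inter_leafNbrs hRu hus
        exact ⟨w, hw.2, fun h => absurd hv h, fun _ => ⟨hwl, u, huv, huw⟩⟩
      · exact ⟨v, hv, fun _ => rfl, fun h => absurd h hv⟩
    choose f hfR hf1 hf2 using hex
    have hB' := isPacking_iff.1 hB
    -- a vertex with an out-neighbor sees `f b` only if it sees `b`
    have hpull : ∀ u b c, D.Adj u c → f b ∈ D.closedOutNbhd u → b ∈ D.closedOutNbhd u := by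
      intro u b c huc hfb
      by_cases hb : b ∈ R
      · obtain ⟨hl, p, hpb, hpf⟩ := hf2 b hb
        rcases mem_closedOutNbhd.1 hfb with huf | rfl
        · exact mem_closedOutNbhd.2 (Or.inl (h.parent_unique huf hpf ▸ hpb))
        · exact absurd huc (hl c)
      · rwa [hf1 b hb] at hfb
    have hinj : Set.InjOn f B := by
      have hkey : ∀ a ∈ B, ∀ b ∈ B, a ∈ R → f a = f b → a = b := by
        intro a ha b hb haR hab
        obtain ⟨-, p, hpa, hpf⟩ := hf2 a haR
        exact hB' p a ha b hb (mem_closedOutNbhd.2 (Or.inl hpa))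
          (hpull p b a hpa (hab ▸ mem_closedOutNbhd.2 (Or.inl hpf)))
      intro a ha b hb hab
      by_cases haR : a ∈ R
      · exact hkey a ha b hb haR hab
      by_cases hbR : b ∈ R
      · exact (hkey b hb a ha hbR hab.symm).symm
      · rwa [hf1 a haR, hf1 b hbR] at hab
    let g : V → (Rᶜ : Set V) := fun v => ⟨f v, hfR v⟩
    have hg : Set.InjOn g B := fun a ha b hb hab => hinj ha hb (congrArg Subtype.val hab)
    rw [← hg.ncard_image]
    refine IsPacking.ncard_le_packingNumber (isPacking_induce_iff.2 ?_)
    rintro v hv _ ⟨a, ha, rfl⟩ _ ⟨b, hb, rfl⟩ hav hbv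
    -- A kept leaf may equal `f b` without seeing `b`, so `hpull` fails there; but its closed
    -- out-neighborhood is a singleton.
    by_cases hvl : v ∈ D.leaves
    · have h1 := (mem_closedOutNbhd.1 hav).resolve_left (hvl _)
      have h2 := (mem_closedOutNbhd.1 hbv).resolve_left (hvl _)
      exact Subtype.ext (h1.trans h2.symm)
    · obtain ⟨c, hc⟩ : ∃ c, D.Adj v c := by
        by_contra! hcon
        exact hvl hcon
      rw [hB' v a ha b hb (hpull v a c hc hav) (hpull v b c hc hbv)]

/-- Exactly `s` leaves are kept, so `ℓ - s` vertices are deleted; the additive form avoids truncated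
subtraction. -/
lemma IsRootedTreeAt.card_compl_add_ncard_leaves (h : D.IsRootedTreeAt r) (hV : 2 ≤ Nat.card V)
    {R : Set V} (hR : D.IsPruningSet R) :
    Nat.card (Rᶜ : Set V) + D.leaves.ncard = Nat.card V + D.supportVertices.ncard := by
  obtain ⟨hRl, hRu⟩ := isPruningSet_iff.1 hR
  have h1 := h.ncard_leaf_transversal hV Set.sdiff_subset hRu
  have h2 := Set.ncard_sdiff_add_ncard_of_subset hRl
  have h3 := Set.ncard_add_ncard_compl R
  rw [Nat.card_coe_set_eq]
  omega

end Digraph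

/-! ### Assembly of (i) and (ii) -/

theorem mainTheorem5 {V : Type*} [Finite V] (T : Digraph V) (hT : T.IsRootedTree)
    (n l s : ℕ) (hn : n = Nat.card V) (hn2 : 2 ≤ n)
    (hl : l = T.leaves.ncard) (hs : s = T.supportVertices.ncard) :
    (T.packingNumber = s ↔
      (n = l + s ∨
        (n ≠ l + s ∧ ∀ x, x ∉ T.supportVertices → x ∉ T.leaves →
          ∃ u ∈ T.supportVertices, T.Adj u x))) ∧
    (∃ R, T.IsPruningSet R) ∧
    (∀ R, T.IsPruningSet R →
      ((T.packingNumber : ℤ) = ⌈((n : ℚ) - (l : ℚ) + (s : ℚ)) / 2⌉ ↔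
        (T.induce Rᶜ).MemPhi)) := by
  obtain ⟨r, hr⟩ := hT
  have hV : 2 ≤ Nat.card V := hn ▸ hn2
  refine ⟨?_, hr.exists_isPruningSet, fun R hR => ?_⟩
  · rw [hs, hr.packingNumber_eq_ncard_supportVertices_iff hV]
    refine ⟨fun h => or_iff_not_imp_left.2 fun hne => ⟨hne, h⟩, ?_⟩
    rintro (heq | ⟨-, h⟩)
    -- Leaves and support vertices are disjoint, so `n = ℓ + s` makes them exhaust the tree and the
    -- condition is vacuous.
    · rw [hn, hl, ← Digraph.ncard_leaves_union_supportVertices] at heq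
      have huniv := (Set.eq_univ_iff_ncard _).2 heq.symm
      intro x hxs hxl
      have hx : x ∈ T.leaves ∪ T.supportVertices := huniv ▸ Set.mem_univ x
      exact absurd hx (not_or.2 ⟨hxl, hxs⟩)
    · exact h
  · have hcard := hr.card_compl_add_ncard_leaves hV hR
    rw [← hn, ← hl, ← hs] at hcard
    have hcast : (n : ℚ) - l + s = (Nat.card (Rᶜ : Set V) : ℚ) := by
      have : (Nat.card (Rᶜ : Set V) : ℚ) + l = n + s := by exact_mod_cast hcard
      linarith
    rw [hcast, ← hr.packingNumber_induce_compl hV hR]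
    exact Digraph.packingNumber_eq_ceil_iff_memPhi
      ⟨_, hr.induce_compl hR.1 fun hrR => hr.root_notMem_leaves hV (hR.1 hrR)⟩
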